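/- **Theorem 5.7.** Let $(M,g)$ be an oriented smooth $4$-dimensional semi-Riemannian manifold (without boundary) of neutral signature $(+,+,-,-)$, with Ricci tensor $S$, scalar curvature $r$ and Levi-Civita connection $\nabla$. Let $f>0$ be a smooth function on $M$, and equip $\tilde M=M\times\mathbb R$ with the static metric $\tilde g=g-f^2\,dt^2$, with Ricci tensor $\tilde S$ and scalar curvature $\tilde r$. Suppose that: 1. $(M,g)$ is half conformally flat, i.e. its Weyl tensor is self-dual or anti-self-dual; 2. $(\tilde M,\tilde g)$ is a static perfect fluid spacetime: there are smooth functions $\rho$ (isotropic pressure) and $\sigma$ (energy density) on $\tilde M$ with $$\tilde S-\tfrac{\tilde r}{2}\,\tilde g=\rho\, g+\sigma f^2\,dt^2 ;$$ 3. the fluid is stiff matter, i.e. $\sigma=\rho$; 4. $g$ is an almost gradient Ricci soliton with potential function $f$: there is a smooth function $\lambda$ on $M$ with $$\nabla^2 f+S+\lambda g=0 ;$$ 5. $\|\nabla f\|=0$, i.e. $g(\nabla f,\nabla f)=0$ on $M$. Then $\lambda=\dfrac{r}{12}$ on $M$. Consequently the soliton is expanding ($\lambda>0$ on $M$), steady ($\lambda=0$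 on $M$) or shrinking ($\lambda<0$ on $M$) if and only if $r$ is, respectively, positive, zero or negative on $M$. -/

import Mathlib

open scoped Manifold ContDiff

set_option maxSynthPendingDepth 3

noncomputable section

namespace SemiRiem

/-! ## Local geometry: a metric on an open part of a vector space

`G y` is the metric at the point `y`, written in the coordinates of the vector space `E`. -/

section Coordinates

variable {E : Type*} [NormedAddCommGroup E] [NormedSpace ℝ E]

/-- The cyclic change of arguments `(a, b, c) ↦ T c a b` of a trilinear map. -/
def cycle {F : Type*} [NormedAddCommGroup F] [NormedSpace ℝ F] (T : E →L[ℝ] E →L[ℝ] E →L[ℝ] F) :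
    E →L[ℝ] E →L[ℝ] E →L[ℝ] F :=
  ((ContinuousLinearMap.flipₗᵢ ℝ E E F).toContinuousLinearEquiv :
    (E →L[ℝ] E →L[ℝ] F) →L[ℝ] (E →L[ℝ] E →L[ℝ] F)).comp T.flip

@[simp] theorem cycle_apply {F : Type*} [NormedAddCommGroup F] [NormedSpace ℝ F]
    (T : E →L[ℝ] E →L[ℝ] E →L[ℝ] F) (a b c : E) : cycle T a b c = T c a b := rfl

/-- The Christoffel symbols of the first kind,
`(u, v, w) ↦ ½ (∂_u G(v, w) + ∂_v G(u, w) - ∂_w G(u, v))`. -/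
def christoffelLower (G : E → E →L[ℝ] E →L[ℝ] ℝ) (y : E) : E →L[ℝ] E →L[ℝ] E →L[ℝ] ℝ :=
  let D : E →L[ℝ] E →L[ℝ] E →L[ℝ] ℝ := fderiv ℝ G y
  (1 / 2 : ℝ) • (D + D.flip - cycle D)

theorem christoffelLower_apply (G : E → E →L[ℝ] E →L[ℝ] ℝ) (y u v w : E) :
    christoffelLower G y u v w =
      1 / 2 * (fderiv ℝ G y u v w + fderiv ℝ G y v u w - fderiv ℝ G y w u v) := by
  simp [christoffelLower]

/-- The Christoffel symbols `Γ(u, v)` of the Levi-Civita connection of `G`: the index of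
`christoffelLower` is raised with the inverse metric. -/
def christoffel (G : E → E →L[ℝ] E →L[ℝ] ℝ) (y : E) : E →L[ℝ] E →L[ℝ] E :=
  (ContinuousLinearMap.compL ℝ E (E →L[ℝ] ℝ) E (G y).inverse).comp (christoffelLower G y)

theorem christoffel_apply (G : E → E →L[ℝ] E →L[ℝ] ℝ) (y u v : E) :
    christoffel G y u v = (G y).inverse (christoffelLower G y u v) := rfl

/-- The trilinear map `(u, v, w) ↦ Γ(u, Γ(v, w))`. -/
def christoffelSq (G : E → E →L[ℝ] E →L[ℝ] ℝ) (y : E) : E →L[ℝ] E →L[ℝ] E →L[ℝ] E :=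
  ((ContinuousLinearMap.compL ℝ E (E →L[ℝ] E) (E →L[ℝ] E)).flip (christoffel G y)).comp
    ((ContinuousLinearMap.compL ℝ E E E).comp (christoffel G y))

/-- The Riemann curvature `R(u, v)w` of `G`. -/
def curvature (G : E → E →L[ℝ] E →L[ℝ] ℝ) (y : E) : E →L[ℝ] E →L[ℝ] E →L[ℝ] E :=
  fderiv ℝ (christoffel G) y - (fderiv ℝ (christoffel G) y).flip
    + christoffelSq G y - (christoffelSq G y).flip

theorem curvature_apply (G : E → E →L[ℝ] E →L[ℝ] ℝ) (y u v w : E) :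
    curvature G y u v w =
      fderiv ℝ (christoffel G) y u v w - fderiv ℝ (christoffel G) y v u w
        + christoffel G y u (christoffel G y v w) - christoffel G y v (christoffel G y u w) := rfl

/-- The Hessian `∇²F(u, v) = D²F(u, v) - DF(Γ(u, v))` with respect to `G`. -/
def hessian (G : E → E →L[ℝ] E →L[ℝ] ℝ) (F : E → ℝ) (y : E) : E →L[ℝ] E →L[ℝ] ℝ :=
  fderiv ℝ (fderiv ℝ F) y
    - (ContinuousLinearMap.compL ℝ E E ℝ (fderiv ℝ F y)).comp (christoffel G y)

theorem hessian_apply (G : E → E →L[ℝ] E →L[ℝ] ℝ) (F : E → ℝ) (y u v : E) :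
    hessian G F y u v =
      fderiv ℝ (fderiv ℝ F) y u v - fderiv ℝ F y (christoffel G y u v) := rfl

variable [FiniteDimensional ℝ E]

/-- The Ricci curvature `(v, w) ↦ trace (u ↦ R(u, v)w)`. -/
def ricci (G : E → E →L[ℝ] E →L[ℝ] ℝ) (y : E) : E →L[ℝ] E →L[ℝ] ℝ :=
  (ContinuousLinearMap.compL ℝ E (E →L[ℝ] E) ℝ
    (LinearMap.toContinuousLinearMap
      ((LinearMap.trace ℝ E).comp (ContinuousLinearMap.coeLM ℝ)))).comp (cycle (curvature G y))

theorem ricci_apply (G : E → E →L[ℝ] E →L[ℝ] ℝ) (y v w : E) :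
    ricci G y v w =
      LinearMap.trace ℝ E (((curvature G y).flip v).flip w : E →L[ℝ] E).toLinearMap := rfl

end Coordinates

/-! ## Semi-Riemannian manifolds without boundary -/

section Manifold

variable {E : Type*} [NormedAddCommGroup E] [NormedSpace ℝ E]
  {H : Type*} [TopologicalSpace H] (I : ModelWithCorners ℝ E H)
  {M : Type*} [TopologicalSpace M] [ChartedSpace H M]

/-- A field of bilinear forms on the tangent spaces of `M`. -/
abbrev BilinField (M : Type*) [TopologicalSpace M] [ChartedSpace H M] :=
  ∀ x : M, TangentSpace I x →L[ℝ] TangentSpace I x →L[ℝ] ℝ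

variable {I}

/-- The bilinear form at `x`, regarded as a form on the model space. -/
abbrev formAt (g : BilinField I M) (x : M) : E →L[ℝ] E →L[ℝ] ℝ := g x

/-- The coordinate expression of `g` in the preferred chart `φ` at `x₀`, that is, the pullback of
`g` under `φ⁻¹`. -/
def inChart (g : BilinField I M) (x₀ : M) (y : E) : E →L[ℝ] E →L[ℝ] ℝ :=
  let dψ : E →L[ℝ] E := mfderiv 𝓘(ℝ, E) I (extChartAt I x₀).symm y
  (formAt g ((extChartAt I x₀).symm y)).bilinearComp dψ dψ

theorem inChart_apply (g : BilinField I M) (x₀ : M) (y u v : E) :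
    inChart g x₀ y u v = g ((extChartAt I x₀).symm y)
      (mfderiv 𝓘(ℝ, E) I (extChartAt I x₀).symm y u)
      (mfderiv 𝓘(ℝ, E) I (extChartAt I x₀).symm y v) := rfl

/-- `g` is a (smooth) semi-Riemannian metric: symmetric, nondegenerate, with smooth coordinate
expressions. -/
structure IsSemiRiemannianMetric (g : BilinField I M) : Prop where
  symm : ∀ x (u v : TangentSpace I x), g x u v = g x v u
  nondegenerate : ∀ x (u : TangentSpace I x), (∀ v : TangentSpace I x, g x u v = 0) → u = 0
  smooth : ∀ x₀ : M, ContDiffOn ℝ ∞ (inChart g x₀) (extChartAt I x₀).target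

/- Curvature and Hessian are tensors. Their values at `x` are computed in the preferred chart at
`x`, through which `TangentSpace I x` is identified with the model space `E`. -/

/-- The curvature operator `R(u, v)w` of `g` at `x`. -/
def riemannTensor (g : BilinField I M) (x : M) (u v w : TangentSpace I x) : TangentSpace I x :=
  (curvature (inChart g x) (extChartAt I x x) : E →L[ℝ] E →L[ℝ] E →L[ℝ] E) u v w

/-- The Ricci tensor of `g` at `x`. -/
def ricciTensor [FiniteDimensional ℝ E] (g : BilinField I M) : BilinField I M :=
  fun x => (ricci (inChart g x) (extChartAt I x x) : E →L[ℝ] E →L[ℝ] ℝ)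

/-- The Hessian of the function `f` with respect to `g`. -/
def hessianTensor (g : BilinField I M) (f : M → ℝ) : BilinField I M :=
  fun x => (hessian (inChart g x) (f ∘ (extChartAt I x).symm) (extChartAt I x x) :
    E →L[ℝ] E →L[ℝ] ℝ)

/-- The tangent vector dual to a covector with respect to `g`. -/
def sharp (g : BilinField I M) (x : M) : (TangentSpace I x →L[ℝ] ℝ) →L[ℝ] TangentSpace I x :=
  (g x).inverse

/-- The gradient `∇f` with respect to `g`. -/
def gradient (g : BilinField I M) (f : M → ℝ) (x : M) : TangentSpace I x :=
  sharp g x (mfderiv I 𝓘(ℝ, ℝ) f x)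

/-- The Ricci operator `Q`, with `g(Qu, v) = S(u, v)`. -/
def ricciOperator [FiniteDimensional ℝ E] (g : BilinField I M) (x : M) :
    TangentSpace I x →L[ℝ] TangentSpace I x :=
  (sharp g x).comp (ricciTensor g x)

/-- The scalar curvature `r`, the trace of the Ricci operator. -/
def scalarCurvature [FiniteDimensional ℝ E] (g : BilinField I M) (x : M) : ℝ :=
  LinearMap.trace ℝ (TangentSpace I x) (ricciOperator g x).toLinearMap

/-- The Weyl conformal curvature operator `W(u, v)w`, where `n = dim M`. -/
def weylOperator [FiniteDimensional ℝ E] (g : BilinField I M) (x : M)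
    (u v w : TangentSpace I x) : TangentSpace I x :=
  let n : ℝ := Module.finrank ℝ E
  riemannTensor g x u v w
    + (scalarCurvature g x / ((n - 1) * (n - 2))) • (g x v w • u - g x u w • v)
    - (1 / (n - 2)) • (ricciTensor g x v w • u - ricciTensor g x u w • v
        + g x v w • ricciOperator g x u - g x u w • ricciOperator g x v)

/-- The Weyl tensor `W(u, v, w, z) = g(W(u, v)w, z)`. -/
def weylTensor [FiniteDimensional ℝ E] (g : BilinField I M) (x : M)
    (u v w z : TangentSpace I x) : ℝ :=
  g x (weylOperator g x u v w) z

/-- `(g, f, L)` is an almost gradient Ricci soliton with potential function `f` and soliton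
function `L`: `∇²f + S + L g = 0`, the function `L` being smooth. -/
structure IsAlmostGradientRicciSoliton [FiniteDimensional ℝ E] (g : BilinField I M)
    (f L : M → ℝ) : Prop where
  smooth_potential : ContMDiff I 𝓘(ℝ, ℝ) ∞ f
  smooth_soliton : ContMDiff I 𝓘(ℝ, ℝ) ∞ L
  equation : ∀ (x : M) (u v : TangentSpace I x),
    hessianTensor g f x u v + ricciTensor g x u v + L x * g x u v = 0

/-- A soliton `∇²f + S + L g = 0` is expanding if `L > 0`. -/
def IsExpanding (L : M → ℝ) : Prop := ∀ x, 0 < L x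

/-- A soliton `∇²f + S + L g = 0` is steady if `L = 0`. -/
def IsSteady (L : M → ℝ) : Prop := ∀ x, L x = 0

/-- A soliton `∇²f + S + L g = 0` is shrinking if `L < 0`. -/
def IsShrinking (L : M → ℝ) : Prop := ∀ x, L x < 0

/-! ### Static spacetimes -/

/-- The static metric `g - f² dt²` on `M × ℝ`. -/
def staticMetric (g : BilinField I M) (f : M → ℝ) : BilinField (I.prod 𝓘(ℝ, ℝ)) (M × ℝ) :=
  fun p =>
    ((formAt g p.1).bilinearComp
        (ContinuousLinearMap.fst ℝ E ℝ) (ContinuousLinearMap.fst ℝ E ℝ)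
      - (f p.1) ^ 2 •
        (ContinuousLinearMap.snd ℝ E ℝ).smulRight (ContinuousLinearMap.snd ℝ E ℝ) :
      (E × ℝ) →L[ℝ] (E × ℝ) →L[ℝ] ℝ)

theorem staticMetric_apply (g : BilinField I M) (f : M → ℝ) (x : M) (t : ℝ)
    (u v : TangentSpace I x) (a b : ℝ) :
    staticMetric g f (x, t) ((u, a) : E × ℝ) ((v, b) : E × ℝ) = g x u v - f x ^ 2 * (a * b) := rfl

/-- `M × ℝ` with the metric `g - f² dt²`, `f > 0`, is a static perfect fluid spacetime with
isotropic pressure `ρ` and energy density `σ`: the Einstein equation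
`S̃ - (r̃/2) g̃ = ρ g + σ f² dt²` holds. A tangent vector of `M × ℝ` at `(x, t)` is a pair
`(u, a)`, where `u` is tangent to `M` at `x` and `a = dt(u, a)`. -/
structure IsStaticPerfectFluid [FiniteDimensional ℝ E] (g : BilinField I M) (f : M → ℝ)
    (ρ σ : M × ℝ → ℝ) : Prop where
  metric : IsSemiRiemannianMetric g
  smooth_warping : ContMDiff I 𝓘(ℝ, ℝ) ∞ f
  warping_pos : ∀ x, 0 < f x
  smooth_pressure : ContMDiff (I.prod 𝓘(ℝ, ℝ)) 𝓘(ℝ, ℝ) ∞ ρ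
  smooth_density : ContMDiff (I.prod 𝓘(ℝ, ℝ)) 𝓘(ℝ, ℝ) ∞ σ
  einstein : ∀ (x : M) (t : ℝ) (u v : TangentSpace I x) (a b : ℝ),
    ricciTensor (staticMetric g f) (x, t) ((u, a) : E × ℝ) ((v, b) : E × ℝ)
      - scalarCurvature (staticMetric g f) (x, t) / 2
        * staticMetric g f (x, t) ((u, a) : E × ℝ) ((v, b) : E × ℝ)
      = ρ (x, t) * g x u v + σ (x, t) * (f x ^ 2 * (a * b))

/-- A perfect fluid is a stiff matter fluid if its energy density equals its pressure. -/
def IsStiff (ρ σ : M × ℝ → ℝ) : Prop := ∀ p, σ p = ρ p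

end Manifold

/-! ## Four-dimensional metrics of neutral signature -/

section Dimension4

variable {M : Type*} [TopologicalSpace M] [ChartedSpace (EuclideanSpace ℝ (Fin 4)) M]

/-- `e` is an orthonormal frame of signature `(+, +, -, -)` at `x`. -/
def IsNeutralFrame (g : BilinField (𝓡 4) M) (x : M) (e : Fin 4 → TangentSpace (𝓡 4) x) : Prop :=
  ∀ i j, g x (e i) (e j) = if i = j then (if i < 2 then 1 else -1) else 0

/-- `g` has neutral signature `(2, 2)`. -/
def IsNeutral (g : BilinField (𝓡 4) M) : Prop := ∀ x, ∃ e, IsNeutralFrame g x e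

/-- `vol` is a smooth volume form of the metric `g`: it takes the values `±1` on orthonormal frames.
Such a form is the same as an orientation of `M`; the positively oriented frames are those with
`vol > 0`. -/
structure IsVolumeForm (g : BilinField (𝓡 4) M)
    (vol : ∀ x : M, (TangentSpace (𝓡 4) x) [⋀^Fin 4]→ₗ[ℝ] ℝ) : Prop where
  unit : ∀ x e, IsNeutralFrame g x e → |vol x e| = 1
  smooth : ∀ (x₀ : M) (u : Fin 4 → EuclideanSpace ℝ (Fin 4)),
    ContDiffOn ℝ ∞ (fun y => vol ((extChartAt (𝓡 4) x₀).symm y)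
      (fun i => mfderiv 𝓘(ℝ, EuclideanSpace ℝ (Fin 4)) (𝓡 4) (extChartAt (𝓡 4) x₀).symm y (u i)))
      (extChartAt (𝓡 4) x₀).target

/-- The coordinate basis vectors of the tangent space at `x`. -/
def coordVector (x : M) (k : Fin 4) : TangentSpace (𝓡 4) x :=
  (EuclideanSpace.single k (1 : ℝ) : EuclideanSpace ℝ (Fin 4))

/-- The basis of the tangent space at `x` that is `g`-dual to the coordinate basis. -/
def dualCoordVector (g : BilinField (𝓡 4) M) (x : M) (k : Fin 4) : TangentSpace (𝓡 4) x :=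
  sharp g x (EuclideanSpace.proj k : EuclideanSpace ℝ (Fin 4) →L[ℝ] ℝ)

/-- The Hodge star acting on the first pair of arguments of the Weyl tensor,
`(⋆W)_{abcd} = ½ vol_{ab}{}^{kl} W_{klcd}`. -/
def starWeyl (g : BilinField (𝓡 4) M) (vol : ∀ x : M, (TangentSpace (𝓡 4) x) [⋀^Fin 4]→ₗ[ℝ] ℝ)
    (x : M) (u v w z : TangentSpace (𝓡 4) x) : ℝ :=
  (1 / 2) * ∑ k : Fin 4, ∑ l : Fin 4,
    vol x ![u, v, coordVector x k, coordVector x l]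
      * weylTensor g x (dualCoordVector g x k) (dualCoordVector g x l) w z

/-- `g` is self-dual: `⋆W = W`, that is, `W⁻ = 0`. -/
def IsSelfDual (g : BilinField (𝓡 4) M)
    (vol : ∀ x : M, (TangentSpace (𝓡 4) x) [⋀^Fin 4]→ₗ[ℝ] ℝ) : Prop :=
  ∀ (x : M) (u v w z : TangentSpace (𝓡 4) x), starWeyl g vol x u v w z = weylTensor g x u v w z

/-- `g` is anti-self-dual: `⋆W = -W`, that is, `W⁺ = 0`. -/
def IsAntiSelfDual (g : BilinField (𝓡 4) M)
    (vol : ∀ x : M, (TangentSpace (𝓡 4) x) [⋀^Fin 4]→ₗ[ℝ] ℝ) : Prop :=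
  ∀ (x : M) (u v w z : TangentSpace (𝓡 4) x), starWeyl g vol x u v w z = -weylTensor g x u v w z

/-- `g` is half conformally flat with respect to the orientation given by the volume form `vol`. -/
def IsHalfConformallyFlat (g : BilinField (𝓡 4) M)
    (vol : ∀ x : M, (TangentSpace (𝓡 4) x) [⋀^Fin 4]→ₗ[ℝ] ℝ) : Prop :=
  IsSelfDual g vol ∨ IsAntiSelfDual g vol

end Dimension4

end SemiRiem

end

/-!
The hypotheses already force `r = 0` and `L = 0`, and this is how the identity `L = r / 12` holds.

For a stiff fluid the Einstein equation reads `S̃ - (r̃/2) g̃ = ρ (g + f² dt²)`. Its trace gives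
`r̃ = -2ρ`, hence `S̃ = 2ρ f² dt²`, and so `S̃` vanishes on vectors tangent to `M`
(`SemiRiem.horizontal_eq_zero_of_einstein`). For the static metric `g̃ = g - f² dt²` this part of the
Ricci tensor is `S - ∇²f / f` (`SemiRiem.ricci_staticForm`, computed from the Christoffel symbols of
`g̃`), so `∇²f = f S`. With the soliton equation this gives `(1 + f) S = -L g` and
`(1 + f) ∇²f = -f L g`.

Differentiating `g(∇f, ∇f) = 0` shows `∇²f(·, ∇f) = 0` (`SemiRiem.hessian_gradient_eq_zero`), hence
`L df = 0`. If `L` were nonzero at a point, then `df = 0` near that point, so `∇²f = 0` there, which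
contradicts `(1 + f) ∇²f = -f L g`. Thus `L = 0` (`SemiRiem.solitonFunction_eq_zero`), and then
`S = 0` and `r = 0`.
-/

noncomputable section

namespace SemiRiem

open Filter Topology ContinuousLinearMap

/-! ### Derivatives and inverses of bilinear forms -/

section Calculus

variable {E A B C : Type*} [NormedAddCommGroup E] [NormedSpace ℝ E]
  [NormedAddCommGroup A] [NormedSpace ℝ A] [NormedAddCommGroup B] [NormedSpace ℝ B]
  [NormedAddCommGroup C] [NormedSpace ℝ C]

/-- The derivative of a field of bilinear maps, evaluated on constant vectors. It reduces derivatives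
of metrics and Christoffel symbols to those of their components. -/
theorem fderiv_apply_apply {T : E → A →L[ℝ] B →L[ℝ] C} {y : E} (hT : DifferentiableAt ℝ T y)
    (w : E) (a : A) (b : B) :
    fderiv ℝ T y w a b = fderiv ℝ (fun z => T z a b) y w := by
  have h := ((hT.hasFDerivAt.clm_apply (hasFDerivAt_const a y)).clm_apply
    (hasFDerivAt_const b y)).fderiv
  rw [h]
  simp

theorem isInvertible_of_nondegenerate [FiniteDimensional ℝ E] {B : E →L[ℝ] E →L[ℝ] ℝ}
    (hB : ∀ u, (∀ v, B u v = 0) → u = 0) : B.IsInvertible := by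
  have hinj : Function.Injective (B : E →ₗ[ℝ] E →L[ℝ] ℝ) := by
    rw [← LinearMap.ker_eq_bot, LinearMap.ker_eq_bot']
    exact fun u hu => hB u fun v => by simpa using congrArg (fun T : E →L[ℝ] ℝ => T v) hu
  have hdim : Module.finrank ℝ E = Module.finrank ℝ (E →L[ℝ] ℝ) := by
    rw [← Subspace.dual_finrank_eq (K := ℝ) (V := E)]
    exact (LinearMap.toContinuousLinearMap (𝕜 := ℝ) (E := E) (F' := ℝ)).finrank_eq
  exact ⟨(LinearEquiv.ofInjectiveOfFinrankEq _ hinj hdim).toContinuousLinearEquiv, by ext; rfl⟩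

end Calculus

/-! ### The Levi-Civita connection and the Hessian in coordinates -/

section Connection

variable {E : Type*} [NormedAddCommGroup E] [NormedSpace ℝ E]

theorem apply_christoffel {G : E → E →L[ℝ] E →L[ℝ] ℝ} {y : E} (hG : (G y).IsInvertible) (u v : E) :
    G y (christoffel G y u v) = christoffelLower G y u v :=
  hG.self_apply_inverse _

theorem differentiableAt_christoffel [CompleteSpace E] {G : E → E →L[ℝ] E →L[ℝ] ℝ} {y : E}
    (hG : ContDiffAt ℝ 2 G y) (hinv : (G y).IsInvertible) :
    DifferentiableAt ℝ (christoffel G) y := by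
  have hD : DifferentiableAt ℝ (fderiv ℝ G) y :=
    (hG.fderiv_right (m := 1) (by norm_num)).differentiableAt one_ne_zero
  have hflip : DifferentiableAt ℝ (fun z => (fderiv ℝ G z).flip) y :=
    ((flipₗᵢ ℝ E E (E →L[ℝ] ℝ)).toContinuousLinearEquiv.differentiableAt).comp y hD
  have hcycle : DifferentiableAt ℝ (fun z => cycle (fderiv ℝ G z)) y :=
    (differentiableAt_const _).clm_comp hflip
  have hlower : DifferentiableAt ℝ (christoffelLower G) y :=
    ((hD.add hflip).sub hcycle).const_smul (1 / 2 : ℝ)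
  have hinverse : DifferentiableAt ℝ (fun z => (G z).inverse) y :=
    ((hinv.contDiffAt_map_inverse (n := 1)).differentiableAt one_ne_zero).comp y
      (hG.differentiableAt two_ne_zero)
  exact ((compL ℝ E (E →L[ℝ] ℝ) E).differentiableAt.comp y hinverse).clm_comp hlower

/-- If `dF` is null near `y`, then differentiating `G(∇F, ∇F) = 0` gives `∇²F(u, ∇F) = 0`. -/
theorem hessian_gradient_eq_zero [CompleteSpace E] {G : E → E →L[ℝ] E →L[ℝ] ℝ} {F : E → ℝ} {y : E}
    (hG : DifferentiableAt ℝ G y) (hinv : ∀ᶠ z in 𝓝 y, (G z).IsInvertible)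
    (hsymm : ∀ u v, G y u v = G y v u) (hF : DifferentiableAt ℝ (fderiv ℝ F) y)
    (hnull : ∀ᶠ z in 𝓝 y, fderiv ℝ F z ((G z).inverse (fderiv ℝ F z)) = 0) (u : E) :
    hessian G F y u ((G y).inverse (fderiv ℝ F y)) = 0 := by
  have hinv0 := hinv.self_of_nhds
  set N : E → E := fun z => (G z).inverse (fderiv ℝ F z) with hN
  have hNd : DifferentiableAt ℝ N y :=
    (((hinv0.contDiffAt_map_inverse (n := 1)).differentiableAt one_ne_zero).comp y hG).clm_apply hF
  have hGN : ∀ᶠ z in 𝓝 y, G z (N z) = fderiv ℝ F z :=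
    hinv.mono fun z hz => hz.self_apply_inverse _
  have hlower : ∀ v, G y (N y) v = fderiv ℝ F y v := fun v => by rw [hGN.self_of_nhds]
  -- the derivatives of `G N = dF` and of `dF(N) = 0`
  have h1 : fderiv ℝ G y u (N y) + G y (fderiv ℝ N y u) = fderiv ℝ (fderiv ℝ F) y u := by
    rw [← (show (fun z => G z (N z)) =ᶠ[𝓝 y] fderiv ℝ F from hGN).fderiv_eq,
      (hG.hasFDerivAt.clm_apply hNd.hasFDerivAt).fderiv]
    simp [add_comm]
  have h2 : fderiv ℝ (fderiv ℝ F) y u (N y) + fderiv ℝ F y (fderiv ℝ N y u) = 0 := by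
    have h := (hF.hasFDerivAt.clm_apply hNd.hasFDerivAt).fderiv
    rw [(show (fun z => fderiv ℝ F z (N z)) =ᶠ[𝓝 y] fun _ => 0 from hnull).fderiv_eq] at h
    have := congrArg (fun T : E →L[ℝ] ℝ => T u) h
    simp at this
    linarith
  have h1' : fderiv ℝ G y u (N y) (N y) + G y (fderiv ℝ N y u) (N y)
      = fderiv ℝ (fderiv ℝ F) y u (N y) := by
    rw [← h1]; rfl
  have h3 : fderiv ℝ F y (christoffel G y u (N y)) = 1 / 2 * fderiv ℝ G y u (N y) (N y) := by
    rw [← hlower, hsymm, apply_christoffel hinv0, christoffelLower_apply]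
    ring
  rw [← hlower, hsymm] at h2
  change hessian G F y u (N y) = 0
  rw [hessian_apply, h3]
  linarith

theorem hessian_eq_zero_of_fderiv_eventuallyEq_zero {G : E → E →L[ℝ] E →L[ℝ] ℝ} {F : E → ℝ} {y : E}
    (hF : ∀ᶠ z in 𝓝 y, fderiv ℝ F z = 0) : hessian G F y = 0 := by
  ext u v
  rw [hessian_apply, (show fderiv ℝ F =ᶠ[𝓝 y] fun _ => 0 from hF).fderiv_eq, hF.self_of_nhds]
  simp

end Connection

/-! ### The metric `G - F² dt²` in coordinates -/

section Static

variable {E : Type*} [NormedAddCommGroup E] [NormedSpace ℝ E]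

/-- The metric `G - F² dt²` on an open part of `E × ℝ`. -/
def staticForm (G : E → E →L[ℝ] E →L[ℝ] ℝ) (F : E → ℝ) (p : E × ℝ) :
    (E × ℝ) →L[ℝ] (E × ℝ) →L[ℝ] ℝ :=
  (G p.1).bilinearComp (fst ℝ E ℝ) (fst ℝ E ℝ) - (F p.1) ^ 2 • (snd ℝ E ℝ).smulRight (snd ℝ E ℝ)

variable {G : E → E →L[ℝ] E →L[ℝ] ℝ} {F : E → ℝ}

theorem staticForm_apply (p U V : E × ℝ) :
    staticForm G F p U V = G p.1 U.1 V.1 - F p.1 ^ 2 * (U.2 * V.2) := rfl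

theorem contDiffAt_staticForm {n : WithTop ℕ∞} {p : E × ℝ} (hG : ContDiffAt ℝ n G p.1)
    (hF : ContDiffAt ℝ n F p.1) : ContDiffAt ℝ n (staticForm G F) p := by
  have hG' : ContDiffAt ℝ n (fun q : E × ℝ => G q.1) p := hG.comp p contDiffAt_fst
  have hF' : ContDiffAt ℝ n (fun q : E × ℝ => F q.1) p := hF.comp p contDiffAt_fst
  have h1 : ContDiffAt ℝ n
      (fun q : E × ℝ => (G q.1).bilinearComp (fst ℝ E ℝ) (fst ℝ E ℝ)) p := by
    have : (fun q : E × ℝ => (G q.1).bilinearComp (fst ℝ E ℝ) (fst ℝ E ℝ)) =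
        fun q => (((compL ℝ (E × ℝ) E ℝ).flip (fst ℝ E ℝ)).comp (G q.1)).comp (fst ℝ E ℝ) := rfl
    rw [this]
    exact (contDiffAt_const.clm_comp hG').clm_comp contDiffAt_const
  exact h1.sub ((hF'.pow 2).smul contDiffAt_const)

theorem isInvertible_staticForm [FiniteDimensional ℝ E] {p : E × ℝ} (hG : (G p.1).IsInvertible)
    (hF : F p.1 ≠ 0) : (staticForm G F p).IsInvertible := by
  refine isInvertible_of_nondegenerate fun U hU => ?_
  have h1 : U.1 = 0 := hG.injective <| by
    ext v; simpa [staticForm_apply] using hU (v, 0)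
  have h2 : U.2 = 0 := by simpa [staticForm_apply, hF] using hU (0, 1)
  exact Prod.ext h1 h2

theorem fderiv_staticForm {p : E × ℝ} (hG : DifferentiableAt ℝ G p.1)
    (hF : DifferentiableAt ℝ F p.1) (hT : DifferentiableAt ℝ (staticForm G F) p) (W U V : E × ℝ) :
    fderiv ℝ (staticForm G F) p W U V =
      fderiv ℝ G p.1 W.1 U.1 V.1 - 2 * F p.1 * fderiv ℝ F p.1 W.1 * (U.2 * V.2) := by
  rw [fderiv_apply_apply hT]
  have hG' : HasFDerivAt (fun q : E × ℝ => G q.1) _ p :=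
    HasFDerivAt.comp p hG.hasFDerivAt hasFDerivAt_fst
  have hF' : HasFDerivAt (fun q : E × ℝ => F q.1) _ p :=
    HasFDerivAt.comp p hF.hasFDerivAt hasFDerivAt_fst
  have h : HasFDerivAt (fun q => staticForm G F q U V) _ p :=
    ((hG'.clm_apply (hasFDerivAt_const U.1 p)).clm_apply (hasFDerivAt_const V.1 p)).sub
      ((hF'.pow 2).mul_const (U.2 * V.2))
  rw [h.fderiv]
  simp
  ring

/-- The Christoffel symbols of `G - F² dt²`, where `N` is the vector `G`-dual to `dF`:
`Γ̃((u, a), (v, b)) = (Γ(u, v) + a b F N, (a dF(v) + b dF(u)) / F)`. -/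
theorem christoffel_staticForm [FiniteDimensional ℝ E] {p : E × ℝ}
    (hG : ContDiffAt ℝ 1 G p.1) (hF : ContDiffAt ℝ 1 F p.1) (hinv : (G p.1).IsInvertible)
    (hF0 : F p.1 ≠ 0) (U V : E × ℝ) :
    christoffel (staticForm G F) p U V =
      (christoffel G p.1 U.1 V.1
          + (U.2 * V.2 * F p.1) • (G p.1).inverse (fderiv ℝ F p.1),
        (U.2 * fderiv ℝ F p.1 V.1 + V.2 * fderiv ℝ F p.1 U.1) / F p.1) := by
  have hinv' := isInvertible_staticForm hinv hF0
  have hT := (contDiffAt_staticForm hG hF).differentiableAt one_ne_zero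
  have hd := fderiv_staticForm (hG.differentiableAt one_ne_zero)
    (hF.differentiableAt one_ne_zero) hT
  apply hinv'.injective
  refine ContinuousLinearMap.ext fun W => ?_
  rw [apply_christoffel hinv']
  simp only [staticForm_apply, christoffelLower_apply, hd, map_add, map_smul, add_apply,
    smul_apply, apply_christoffel hinv, hinv.self_apply_inverse, smul_eq_mul]
  field_simp
  ring

theorem eventually_christoffel_staticForm [FiniteDimensional ℝ E] {p : E × ℝ}
    (hG : ContDiffAt ℝ 2 G p.1) (hF : ContDiffAt ℝ 2 F p.1)
    (hinv : ∀ᶠ y in 𝓝 p.1, (G y).IsInvertible) (hF0 : ∀ᶠ y in 𝓝 p.1, F y ≠ 0) :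
    ∀ᶠ q : E × ℝ in 𝓝 p, ∀ U V, christoffel (staticForm G F) q U V =
      (christoffel G q.1 U.1 V.1 + (U.2 * V.2 * F q.1) • (G q.1).inverse (fderiv ℝ F q.1),
        (U.2 * fderiv ℝ F q.1 V.1 + V.2 * fderiv ℝ F q.1 U.1) / F q.1) := by
  have hcont : Tendsto (Prod.fst : E × ℝ → E) (𝓝 p) (𝓝 p.1) := continuous_fst.continuousAt
  filter_upwards [hcont.eventually hinv, hcont.eventually hF0,
    hcont.eventually ((hG.of_le one_le_two).eventually (by simp)),
    hcont.eventually ((hF.of_le one_le_two).eventually (by simp))] with q h1 h2 h3 h4 U V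
  exact christoffel_staticForm h3 h4 h1 h2 U V

theorem fderiv_christoffel_staticForm_horizontal [FiniteDimensional ℝ E] {p : E × ℝ}
    (hG : ContDiffAt ℝ 2 G p.1) (hF : ContDiffAt ℝ 2 F p.1)
    (hinv : ∀ᶠ y in 𝓝 p.1, (G y).IsInvertible) (hF0 : ∀ᶠ y in 𝓝 p.1, F y ≠ 0)
    (W : E × ℝ) (u v : E) :
    fderiv ℝ (christoffel (staticForm G F)) p W (u, 0) (v, 0) =
      (fderiv ℝ (christoffel G) p.1 W.1 u v, 0) := by
  rw [fderiv_apply_apply (differentiableAt_christoffel (contDiffAt_staticForm hG hF)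
    (isInvertible_staticForm hinv.self_of_nhds hF0.self_of_nhds))]
  have hev : (fun q => christoffel (staticForm G F) q (u, 0) (v, 0)) =ᶠ[𝓝 p]
      fun q => (christoffel G q.1 u v, 0) :=
    (eventually_christoffel_staticForm hG hF hinv hF0).mono fun q hq => by simp [hq]
  have hΓ : HasFDerivAt (fun q : E × ℝ => christoffel G q.1) _ p :=
    HasFDerivAt.comp p (differentiableAt_christoffel hG hinv.self_of_nhds).hasFDerivAt
      hasFDerivAt_fst
  rw [hev.fderiv_eq, (((hΓ.clm_apply (hasFDerivAt_const u p)).clm_apply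
    (hasFDerivAt_const v p)).prodMk (hasFDerivAt_const (0 : ℝ) p)).fderiv]
  simp

theorem fderiv_christoffel_staticForm_vertical [FiniteDimensional ℝ E] {p : E × ℝ}
    (hG : ContDiffAt ℝ 2 G p.1) (hF : ContDiffAt ℝ 2 F p.1)
    (hinv : ∀ᶠ y in 𝓝 p.1, (G y).IsInvertible) (hF0 : ∀ᶠ y in 𝓝 p.1, F y ≠ 0)
    (W : E × ℝ) (v : E) :
    fderiv ℝ (christoffel (staticForm G F)) p W (0, 1) (v, 0) =
      (0, fderiv ℝ (fderiv ℝ F) p.1 W.1 v / F p.1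
        - fderiv ℝ F p.1 v * fderiv ℝ F p.1 W.1 / F p.1 ^ 2) := by
  rw [fderiv_apply_apply (differentiableAt_christoffel (contDiffAt_staticForm hG hF)
    (isInvertible_staticForm hinv.self_of_nhds hF0.self_of_nhds))]
  have hev : (fun q => christoffel (staticForm G F) q (0, 1) (v, 0)) =ᶠ[𝓝 p]
      fun q => (0, fderiv ℝ F q.1 v * (F q.1)⁻¹) :=
    (eventually_christoffel_staticForm hG hF hinv hF0).mono fun q hq => by simp [hq, div_eq_mul_inv]
  have hD : DifferentiableAt ℝ (fderiv ℝ F) p.1 :=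
    (hF.fderiv_right (m := 1) (by norm_num)).differentiableAt one_ne_zero
  have hD' : HasFDerivAt (fun q : E × ℝ => fderiv ℝ F q.1) _ p :=
    HasFDerivAt.comp p hD.hasFDerivAt hasFDerivAt_fst
  have hF' : HasFDerivAt (fun q : E × ℝ => F q.1) _ p :=
    HasFDerivAt.comp p (hF.differentiableAt two_ne_zero).hasFDerivAt hasFDerivAt_fst
  have hF00 := hF0.self_of_nhds
  have h : HasFDerivAt (fun q : E × ℝ => ((0 : E), fderiv ℝ F q.1 v * (F q.1)⁻¹)) _ p :=
    (hasFDerivAt_const (0 : E) p).prodMk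
      ((hD'.clm_apply (hasFDerivAt_const v p)).mul ((hasFDerivAt_inv hF00).comp p hF'))
  rw [hev.fderiv_eq, h.fderiv]
  simp
  field_simp
  ring

/-- The trace of an endomorphism of `E × ℝ` is the sum of the traces of its diagonal blocks. -/
theorem trace_prod_real [FiniteDimensional ℝ E] (T : (E × ℝ) →ₗ[ℝ] E × ℝ) :
    LinearMap.trace ℝ (E × ℝ) T =
      LinearMap.trace ℝ E (LinearMap.fst ℝ E ℝ ∘ₗ T ∘ₗ LinearMap.inl ℝ E ℝ) + (T (0, 1)).2 := by
  have hreal : ∀ f : ℝ →ₗ[ℝ] ℝ, LinearMap.trace ℝ ℝ f = f 1 := fun f => by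
    have : f = f 1 • LinearMap.id := by ext; simp
    rw [this, map_smul, LinearMap.trace_id]
    simp
  have hT : T = (T ∘ₗ LinearMap.inl ℝ E ℝ) ∘ₗ LinearMap.fst ℝ E ℝ
      + (T ∘ₗ LinearMap.inr ℝ E ℝ) ∘ₗ LinearMap.snd ℝ E ℝ := by
    refine LinearMap.ext fun W => ?_
    simp [← map_add]
  conv_lhs => rw [hT]
  rw [map_add, LinearMap.trace_comp_comm', LinearMap.trace_comp_comm' (LinearMap.snd ℝ E ℝ),
    hreal]
  rfl

/-- The horizontal part of the Ricci tensor of `G - F² dt²` is `Ric(G) - ∇²F / F`. -/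
theorem ricci_staticForm [FiniteDimensional ℝ E] {p : E × ℝ}
    (hG : ContDiffAt ℝ 2 G p.1) (hF : ContDiffAt ℝ 2 F p.1)
    (hinv : ∀ᶠ y in 𝓝 p.1, (G y).IsInvertible) (hF0 : ∀ᶠ y in 𝓝 p.1, F y ≠ 0) (u v : E) :
    ricci (staticForm G F) p (u, 0) (v, 0) =
      ricci G p.1 u v - hessian G F p.1 u v / F p.1 := by
  have hinv0 := hinv.self_of_nhds
  have hF00 := hF0.self_of_nhds
  have hchr0 := (eventually_christoffel_staticForm hG hF hinv hF0).self_of_nhds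
  have hhor : ∀ w, (curvature (staticForm G F) p (w, 0) (u, 0) (v, 0)).1 =
      curvature G p.1 w u v := fun w => by
    rw [curvature_apply, curvature_apply,
      fderiv_christoffel_staticForm_horizontal hG hF hinv hF0,
      fderiv_christoffel_staticForm_horizontal hG hF hinv hF0]
    simp [hchr0]
  have hver : (curvature (staticForm G F) p (0, 1) (u, 0) (v, 0)).2 =
      - (hessian G F p.1 u v / F p.1) := by
    rw [curvature_apply, hessian_apply,
      fderiv_christoffel_staticForm_horizontal hG hF hinv hF0,
      fderiv_christoffel_staticForm_vertical hG hF hinv hF0]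
    simp [hchr0]
    field_simp
    ring
  rw [ricci_apply, ricci_apply, trace_prod_real, sub_eq_add_neg, ← hver]
  congr 2
  ext w
  exact hhor w

end Static

/-! ### Curvature depends on the germ of the metric -/

section Germs

variable {E : Type*} [NormedAddCommGroup E] [NormedSpace ℝ E] [FiniteDimensional ℝ E]

theorem ricci_congr {G G' : E → E →L[ℝ] E →L[ℝ] ℝ} {y : E} (h : G =ᶠ[𝓝 y] G') :
    ricci G y = ricci G' y := by
  have hchr : christoffel G =ᶠ[𝓝 y] christoffel G' := by
    filter_upwards [h.eventuallyEq_nhds] with z hz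
    simp only [christoffel, christoffelLower, hz.fderiv_eq, hz.eq_of_nhds]
  simp only [ricci, curvature, christoffelSq, hchr.fderiv_eq, hchr.eq_of_nhds]

end Germs

/-! ### Pointwise linear algebra -/

section LinearAlgebra

variable {E : Type*} [NormedAddCommGroup E] [NormedSpace ℝ E]

/-- The dual norm of a covector is unchanged by pulling back along an isomorphism `D`. -/
theorem bilinearComp_inverse_apply {B : E →L[ℝ] E →L[ℝ] ℝ} {D : E →L[ℝ] E}
    (hB : B.IsInvertible) (hD : D.IsInvertible) (hBD : (B.bilinearComp D D).IsInvertible)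
    (α : E →L[ℝ] ℝ) :
    α.comp D ((B.bilinearComp D D).inverse (α.comp D)) = α (B.inverse α) := by
  have h : (B.bilinearComp D D).inverse (α.comp D) = D.inverse (B.inverse α) := by
    rw [hBD.inverse_apply_eq]
    ext v
    simp [hD.self_apply_inverse, hB.self_apply_inverse]
  rw [h, comp_apply, hD.self_apply_inverse]

/-- If the Einstein tensor of `S` with respect to `B - c dt²` is `ρ (B + c dt²)`, then taking traces
shows that the scalar curvature is `-2ρ`, and so `S` vanishes on `E × 0`. -/
theorem horizontal_eq_zero_of_einstein [FiniteDimensional ℝ E] {B : E →L[ℝ] E →L[ℝ] ℝ}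
    {T S : (E × ℝ) →L[ℝ] (E × ℝ) →L[ℝ] ℝ} {c ρ : ℝ} (hdim : Module.finrank ℝ E ≠ 1)
    (hT : ∀ u v a b, T (u, a) (v, b) = B u v - c * (a * b)) (hTinv : T.IsInvertible)
    (hS : ∀ u v a b,
      S (u, a) (v, b) - LinearMap.trace ℝ (E × ℝ) (T.inverse.comp S).toLinearMap / 2
        * T (u, a) (v, b) = ρ * B u v + ρ * (c * (a * b))) (u v : E) :
    S (u, 0) (v, 0) = 0 := by
  set r := LinearMap.trace ℝ (E × ℝ) (T.inverse.comp S).toLinearMap with hr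
  -- `T⁻¹ S = (r/2) id + ρ (id_E ⊕ -id_ℝ)`, whose trace determines `r`
  have hop : (T.inverse.comp S).toLinearMap =
      LinearMap.prodMap ((r / 2 + ρ) • LinearMap.id) ((r / 2 - ρ) • LinearMap.id) := by
    refine LinearMap.ext fun U => ?_
    change T.inverse (S U) = ((r / 2 + ρ) • U.1, (r / 2 - ρ) • U.2)
    rw [hTinv.inverse_apply_eq]
    refine ContinuousLinearMap.ext fun V => ?_
    have h := hS U.1 V.1 U.2 V.2
    change _ = T ((r / 2 + ρ) • U.1, (r / 2 - ρ) • U.2) (V.1, V.2)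
    change S U V - r / 2 * T (U.1, U.2) (V.1, V.2) = _ at h
    rw [hT] at h ⊢
    simp only [map_smul, smul_apply, smul_eq_mul]
    linarith
  have htr := hr
  rw [hop, LinearMap.trace_prodMap', map_smul, map_smul, LinearMap.trace_id, LinearMap.trace_id,
    Module.finrank_self] at htr
  have hfac : ((Module.finrank ℝ E : ℝ) - 1) * (r / 2 + ρ) = 0 := by
    simp only [smul_eq_mul, Nat.cast_one] at htr
    linarith
  have hsum : r / 2 + ρ = 0 :=
    (mul_eq_zero.mp hfac).resolve_left (sub_ne_zero.mpr (by exact_mod_cast hdim))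
  have h := hS u v 0 0
  rw [hT] at h
  simp only [mul_zero, sub_zero, add_zero] at h
  linear_combination h + B u v * hsum

end LinearAlgebra

/-! ### Semi-Riemannian manifolds and static spacetimes -/

section Manifold

variable {E : Type*} [NormedAddCommGroup E] [NormedSpace ℝ E]
  {H : Type*} [TopologicalSpace H] {I : ModelWithCorners ℝ E H}
  {M : Type*} [TopologicalSpace M] [ChartedSpace H M] {g : BilinField I M} {f L : M → ℝ}

theorem isInvertible_formAt [FiniteDimensional ℝ E] (hg : IsSemiRiemannianMetric g) (x : M) :
    (formAt g x).IsInvertible :=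
  isInvertible_of_nondegenerate (hg.nondegenerate x)

theorem scalarCurvature_eq_zero_of_ricciTensor_eq_zero [FiniteDimensional ℝ E] {x : M}
    (h : ricciTensor g x = 0) : scalarCurvature g x = 0 := by
  simp [scalarCurvature, ricciOperator, h]

variable [I.Boundaryless]

theorem eventually_mem_target (x : M) :
    ∀ᶠ y in 𝓝 (extChartAt I x x), y ∈ (extChartAt I x).target :=
  extChartAt_target_mem_nhds x

theorem contDiffAt_inChart (hg : IsSemiRiemannianMetric g) (x : M) :
    ContDiffAt ℝ ∞ (inChart g x) (extChartAt I x x) :=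
  (hg.smooth x).contDiffAt (extChartAt_target_mem_nhds x)

variable [IsManifold I ∞ M]

-- For a boundaryless model the range of `I` is the whole model space, which turns Mathlib's
-- statements on derivatives within that range into statements on full derivatives.
theorem isInvertible_mfderiv_extChartAt_symm {x : M} {y : E} (hy : y ∈ (extChartAt I x).target) :
    (mfderiv 𝓘(ℝ, E) I (extChartAt I x).symm y).IsInvertible := by
  have : IsManifold I 1 M := IsManifold.of_le (n := ∞) (by simp)
  have h := isInvertible_mfderivWithin_extChartAt_symm hy
  rwa [I.range_eq_univ, mfderivWithin_univ] at h

theorem mdifferentiableAt_extChartAt_symm {x : M} {y : E} (hy : y ∈ (extChartAt I x).target) :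
    MDifferentiableAt 𝓘(ℝ, E) I (extChartAt I x).symm y := by
  have : IsManifold I 1 M := IsManifold.of_le (n := ∞) (by simp)
  have h := mdifferentiableWithinAt_extChartAt_symm hy
  rwa [I.range_eq_univ, mdifferentiableWithinAt_univ] at h

theorem mfderiv_extChartAt_symm_self (x : M) :
    (mfderiv 𝓘(ℝ, E) I (extChartAt I x).symm (extChartAt I x x) : E →L[ℝ] E) = .id ℝ E := by
  have : IsManifold I 1 M := IsManifold.of_le (n := ∞) (by simp)
  have h := mfderivWithin_range_extChartAt_symm (I := I) (x := x)
  rw [I.range_eq_univ, mfderivWithin_univ] at h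
  exact h

/-- The preferred chart at `x` has derivative the identity at `x`, so the coordinate expression of
`g` there is `g` itself. -/
theorem inChart_self (g : BilinField I M) (x : M) :
    inChart g x (extChartAt I x x) = formAt g x := by
  -- generalizing the derivative and the base point avoids rewriting in dependent types
  have h : ∀ D : E →L[ℝ] E, D = .id ℝ E → ∀ z, z = x →
      (formAt g z).bilinearComp D D = formAt g x := by
    rintro _ rfl _ rfl; rfl
  exact h _ (mfderiv_extChartAt_symm_self x) _ (extChartAt_to_inv x)

theorem isInvertible_inChart [FiniteDimensional ℝ E] (hg : IsSemiRiemannianMetric g) {x : M} {y : E}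
    (hy : y ∈ (extChartAt I x).target) : (inChart g x y).IsInvertible := by
  have hD : (mfderiv 𝓘(ℝ, E) I (extChartAt I x).symm y : E →L[ℝ] E).IsInvertible :=
    isInvertible_mfderiv_extChartAt_symm hy
  refine isInvertible_of_nondegenerate fun u hu => hD.injective (Eq.trans ?_ (map_zero _).symm)
  refine hg.nondegenerate _ _ fun v => ?_
  obtain ⟨w, rfl⟩ := hD.surjective v
  exact hu w

theorem contDiffAt_comp_extChartAt_symm (hf : ContMDiff I 𝓘(ℝ, ℝ) ∞ f) (x : M) :
    ContDiffAt ℝ ∞ (f ∘ (extChartAt I x).symm) (extChartAt I x x) :=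
  ((hf.comp_contMDiffOn (contMDiffOn_extChartAt_symm x)).contMDiffAt
    (extChartAt_target_mem_nhds x)).contDiffAt

theorem fderiv_comp_extChartAt_symm (hf : ContMDiff I 𝓘(ℝ, ℝ) ∞ f) {x : M} {y : E}
    (hy : y ∈ (extChartAt I x).target) :
    fderiv ℝ (f ∘ (extChartAt I x).symm) y =
      ContinuousLinearMap.comp (mfderiv I 𝓘(ℝ, ℝ) f ((extChartAt I x).symm y) : E →L[ℝ] ℝ)
        (mfderiv 𝓘(ℝ, E) I (extChartAt I x).symm y : E →L[ℝ] E) := by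
  rw [← mfderiv_eq_fderiv]
  exact mfderiv_comp y (hf.mdifferentiable (by simp) _) (mdifferentiableAt_extChartAt_symm hy)

theorem fderiv_comp_extChartAt_symm_self (hf : ContMDiff I 𝓘(ℝ, ℝ) ∞ f) (x : M) :
    fderiv ℝ (f ∘ (extChartAt I x).symm) (extChartAt I x x) =
      (mfderiv I 𝓘(ℝ, ℝ) f x : E →L[ℝ] ℝ) := by
  have h : ∀ D : E →L[ℝ] E, D = .id ℝ E → ∀ z, z = x →
      ContinuousLinearMap.comp (mfderiv I 𝓘(ℝ, ℝ) f z : E →L[ℝ] ℝ) D =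
        (mfderiv I 𝓘(ℝ, ℝ) f x : E →L[ℝ] ℝ) := by
    rintro _ rfl _ rfl; rfl
  rw [fderiv_comp_extChartAt_symm hf (mem_extChartAt_target x)]
  exact h _ (mfderiv_extChartAt_symm_self x) _ (extChartAt_to_inv x)

/-- If `∇f` is a null vector field, then it lies in the kernel of the Hessian of `f`. -/
theorem hessianTensor_gradient_eq_zero [FiniteDimensional ℝ E] (hg : IsSemiRiemannianMetric g)
    (hf : ContMDiff I 𝓘(ℝ, ℝ) ∞ f) (hnull : ∀ x, g x (gradient g f x) (gradient g f x) = 0)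
    (x : M) (u : TangentSpace I x) : hessianTensor g f x u (gradient g f x) = 0 := by
  have hgrad : gradient g f x = (inChart g x (extChartAt I x x)).inverse
      (fderiv ℝ (f ∘ (extChartAt I x).symm) (extChartAt I x x)) := by
    rw [inChart_self, fderiv_comp_extChartAt_symm_self hf]
    rfl
  rw [hgrad]
  refine hessian_gradient_eq_zero ((contDiffAt_inChart hg x).differentiableAt (by simp))
    ((eventually_mem_target x).mono fun y hy => isInvertible_inChart hg hy) (fun u v => ?_)
    (((contDiffAt_comp_extChartAt_symm hf x).fderiv_right (m := 1)
      (by norm_cast)).differentiableAt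
      one_ne_zero) ?_ u
  · rw [inChart_self]
    exact hg.symm x u v
  · filter_upwards [eventually_mem_target x] with y hy
    rw [fderiv_comp_extChartAt_symm hf hy]
    refine (bilinearComp_inverse_apply (isInvertible_formAt hg _)
      (isInvertible_mfderiv_extChartAt_symm hy) (isInvertible_inChart hg hy) _).trans ?_
    rw [← hnull ((extChartAt I x).symm y)]
    exact congrArg (fun α : E →L[ℝ] ℝ => α (gradient g f ((extChartAt I x).symm y)))
      ((isInvertible_formAt hg ((extChartAt I x).symm y)).self_apply_inverse
        (mfderiv I 𝓘(ℝ, ℝ) f ((extChartAt I x).symm y) : E →L[ℝ] ℝ)).symm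

theorem hessianTensor_eq_zero_of_eventually (hf : ContMDiff I 𝓘(ℝ, ℝ) ∞ f) {x : M}
    (h : ∀ᶠ z in 𝓝 x, mfderiv I 𝓘(ℝ, ℝ) f z = 0) : hessianTensor g f x = 0 := by
  refine hessian_eq_zero_of_fderiv_eventuallyEq_zero ?_
  have hcont : Tendsto (extChartAt I x).symm (𝓝 (extChartAt I x x)) (𝓝 x) := by
    simpa [ContinuousAt] using continuousAt_extChartAt_symm (I := I) x
  filter_upwards [hcont.eventually h, eventually_mem_target x] with y hy hyt
  rw [fderiv_comp_extChartAt_symm hf hyt, hy]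
  exact zero_comp _

/-- In the product chart, `g - f² dt²` is the static form of the coordinate expressions. -/
theorem inChart_staticMetric (g : BilinField I M) (f : M → ℝ) (x : M) (t : ℝ) {p : E × ℝ}
    (hp : p.1 ∈ (extChartAt I x).target) :
    inChart (staticMetric g f) (x, t) p =
      staticForm (inChart g x) (f ∘ (extChartAt I x).symm) p := by
  have hchart : ((extChartAt (I.prod 𝓘(ℝ, ℝ)) (x, t)).symm : E × ℝ → M × ℝ) =
      Prod.map (extChartAt I x).symm id := by
    rw [extChartAt_prod]
    rfl
  have hD : (mfderiv 𝓘(ℝ, E × ℝ) (I.prod 𝓘(ℝ, ℝ))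
      (extChartAt (I.prod 𝓘(ℝ, ℝ)) (x, t)).symm p : E × ℝ →L[ℝ] E × ℝ) =
      ContinuousLinearMap.prodMap (mfderiv 𝓘(ℝ, E) I (extChartAt I x).symm p.1 : E →L[ℝ] E)
        (ContinuousLinearMap.id ℝ ℝ) := by
    rw [hchart, modelWithCornersSelf_prod, ← chartedSpaceSelf_prod]
    refine (mfderiv_prodMap (mdifferentiableAt_extChartAt_symm hp) mdifferentiableAt_id).trans ?_
    rw [mfderiv_id]
    rfl
  have h : ∀ D : E × ℝ →L[ℝ] E × ℝ, D = ContinuousLinearMap.prodMap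
      (mfderiv 𝓘(ℝ, E) I (extChartAt I x).symm p.1 : E →L[ℝ] E) (ContinuousLinearMap.id ℝ ℝ) →
      ∀ z : M × ℝ, z = ((extChartAt I x).symm p.1, p.2) →
      (formAt (staticMetric g f) z).bilinearComp D D =
        staticForm (inChart g x) (f ∘ (extChartAt I x).symm) p := by
    rintro _ rfl _ rfl; rfl
  exact h _ hD _ (by rw [hchart]; rfl)

theorem ricciTensor_staticMetric [FiniteDimensional ℝ E] (hg : IsSemiRiemannianMetric g)
    (hf : ContMDiff I 𝓘(ℝ, ℝ) ∞ f) (hpos : ∀ x, 0 < f x) (x : M) (t : ℝ) (u v : TangentSpace I x) :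
    ricciTensor (staticMetric g f) (x, t) ((u, 0) : E × ℝ) ((v, 0) : E × ℝ) =
      ricciTensor g x u v - hessianTensor g f x u v / f x := by
  have hbase : extChartAt (I.prod 𝓘(ℝ, ℝ)) (x, t) (x, t) = (extChartAt I x x, t) := by
    rw [extChartAt_prod]
    rfl
  have hev : inChart (staticMetric g f) (x, t) =ᶠ[𝓝 (extChartAt I x x, t)]
      staticForm (inChart g x) (f ∘ (extChartAt I x).symm) :=
    ((continuous_fst.tendsto (extChartAt I x x, t)).eventually (eventually_mem_target x)).mono
      fun p hp => inChart_staticMetric g f x t hp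
  have h := ricci_staticForm (p := (extChartAt I x x, t))
    ((contDiffAt_inChart hg x).of_le (by norm_cast))
    ((contDiffAt_comp_extChartAt_symm hf x).of_le (by norm_cast))
    ((eventually_mem_target x).mono fun y hy => isInvertible_inChart hg hy)
    (Eventually.of_forall fun y => (hpos _).ne') u v
  rw [← ricci_congr hev, ← hbase] at h
  refine Eq.trans h ?_
  simp only [Function.comp_apply, extChartAt_to_inv, hbase]
  rfl

/-- For a stiff static perfect fluid `S̃` vanishes on vectors tangent to `M`, that is,
`∇²f = f S`. -/
theorem hessianTensor_eq_mul_ricciTensor_of_isStiff [FiniteDimensional ℝ E]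
    (hdim : Module.finrank ℝ E ≠ 1) {ρ σ : M × ℝ → ℝ} (hfluid : IsStaticPerfectFluid g f ρ σ)
    (hstiff : IsStiff ρ σ) (x : M) (u v : TangentSpace I x) :
    hessianTensor g f x u v = f x * ricciTensor g x u v := by
  have hf0 : f x ≠ 0 := (hfluid.warping_pos x).ne'
  have h : ricciTensor (staticMetric g f) (x, 0) ((u, 0) : E × ℝ) ((v, 0) : E × ℝ) = 0 := by
    refine horizontal_eq_zero_of_einstein (E := E) (B := formAt g x)
      (T := formAt (staticMetric g f) (x, 0)) (S := ricciTensor (staticMetric g f) (x, 0))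
      (c := f x ^ 2) (ρ := ρ (x, 0)) hdim (fun _ _ _ _ => rfl) ?_ (fun u v a b => ?_) u v
    · exact isInvertible_staticForm (p := ((0 : E), (0 : ℝ))) (G := fun _ => formAt g x)
        (F := fun _ => f x) (isInvertible_formAt hfluid.metric x) hf0
    · have := hfluid.einstein x 0 u v a b
      rw [hstiff] at this
      exact this
  rw [ricciTensor_staticMetric hfluid.metric hfluid.smooth_warping hfluid.warping_pos] at h
  field_simp at h
  linarith

/-- The soliton function `L` vanishes: `S` and `∇²f` are multiples of `L g`, so the null vector
`∇f` satisfies `L df = 0`, whereas `df = 0` near a point forces `∇²f = 0`, hence `L = 0`, there. -/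
theorem solitonFunction_eq_zero [FiniteDimensional ℝ E] [Nontrivial E]
    (hg : IsSemiRiemannianMetric g) (hpos : ∀ x, 0 < f x)
    (hhess : ∀ x (u v : TangentSpace I x), hessianTensor g f x u v = f x * ricciTensor g x u v)
    (hsoliton : IsAlmostGradientRicciSoliton g f L)
    (hnull : ∀ x, g x (gradient g f x) (gradient g f x) = 0) (x : M) : L x = 0 := by
  have hf := hsoliton.smooth_potential
  have hmul : ∀ z (u v : TangentSpace I z),
      (1 + f z) * hessianTensor g f z u v = -(f z * L z * g z u v) := fun z u v => by
    have h1 := hhess z u v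
    have h2 := hsoliton.equation z u v
    linear_combination f z * h2 + h1
  have hdf : ∀ z, L z ≠ 0 → mfderiv I 𝓘(ℝ, ℝ) f z = 0 := fun z hz => by
    refine ContinuousLinearMap.ext fun u => ?_
    have h := hmul z u (gradient g f z)
    rw [hessianTensor_gradient_eq_zero hg hf hnull, hg.symm] at h
    have hdual : g z (gradient g f z) u = mfderiv I 𝓘(ℝ, ℝ) f z u :=
      congrArg (fun α : E →L[ℝ] ℝ => α u)
        ((isInvertible_formAt hg z).self_apply_inverse (mfderiv I 𝓘(ℝ, ℝ) f z : E →L[ℝ] ℝ))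
    rw [hdual] at h
    have hcancel : ∀ a : ℝ, f z * L z * a = 0 → a = 0 := fun a ha =>
      (mul_eq_zero.mp ha).resolve_left (mul_ne_zero (hpos z).ne' hz)
    exact hcancel _ (neg_eq_zero.mp (h.symm.trans (mul_zero _)))
  by_contra hx
  have hev : ∀ᶠ z in 𝓝 x, mfderiv I 𝓘(ℝ, ℝ) f z = 0 :=
    (hsoliton.smooth_soliton.continuous.continuousAt.eventually_ne hx).mono hdf
  obtain ⟨e, he⟩ := exists_ne (0 : E)
  refine he (hg.nondegenerate x e fun v => ?_)
  have h := hmul x e v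
  rw [hessianTensor_eq_zero_of_eventually hf hev] at h
  have h0 : f x * L x * g x e v = 0 := neg_eq_zero.mp (h.symm.trans (mul_zero _))
  exact (mul_eq_zero.mp h0).resolve_left (mul_ne_zero (hpos x).ne' hx)

end Manifold

end SemiRiem

end

theorem theorem5p7 {M : Type*} [TopologicalSpace M] [ChartedSpace (EuclideanSpace ℝ (Fin 4)) M]
    [IsManifold (𝓡 4) ∞ M]
    (g : SemiRiem.BilinField (𝓡 4) M)
    (vol : ∀ x : M, (TangentSpace (𝓡 4) x) [⋀^Fin 4]→ₗ[ℝ] ℝ)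
    (f L : M → ℝ) (ρ σ : M × ℝ → ℝ)
    (hneutral : SemiRiem.IsNeutral g)
    (horient : SemiRiem.IsVolumeForm g vol)
    (hhalf : SemiRiem.IsHalfConformallyFlat g vol)
    (hfluid : SemiRiem.IsStaticPerfectFluid g f ρ σ)
    (hstiff : SemiRiem.IsStiff ρ σ)
    (hsoliton : SemiRiem.IsAlmostGradientRicciSoliton g f L)
    (hnull : ∀ x, g x (SemiRiem.gradient g f x) (SemiRiem.gradient g f x) = 0) :
    (∀ x, L x = SemiRiem.scalarCurvature g x / 12) ∧
    (SemiRiem.IsExpanding L ↔ ∀ x, 0 < SemiRiem.scalarCurvature g x) ∧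
    (SemiRiem.IsSteady L ↔ ∀ x, SemiRiem.scalarCurvature g x = 0) ∧
    (SemiRiem.IsShrinking L ↔ ∀ x, SemiRiem.scalarCurvature g x < 0) := by
  have hdim : Module.finrank ℝ (EuclideanSpace ℝ (Fin 4)) ≠ 1 := by simp
  have hhess := SemiRiem.hessianTensor_eq_mul_ricciTensor_of_isStiff hdim hfluid hstiff
  have hL : ∀ x, L x = 0 := SemiRiem.solitonFunction_eq_zero hfluid.metric hfluid.warping_pos hhess
    hsoliton hnull
  have hr : ∀ x, SemiRiem.scalarCurvature g x = 0 := fun x => by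
    refine SemiRiem.scalarCurvature_eq_zero_of_ricciTensor_eq_zero ?_
    refine ContinuousLinearMap.ext fun u => ContinuousLinearMap.ext fun v => ?_
    have h := hsoliton.equation x u v
    rw [hhess, hL, zero_mul, add_zero, ← add_one_mul] at h
    -- `h` now reads `(f + 1) S = 0`
    exact (mul_eq_zero.mp h).resolve_left (by linarith [hfluid.warping_pos x])
  have key : ∀ x, L x = SemiRiem.scalarCurvature g x / 12 := fun x => by rw [hL, hr, zero_div]
  refine ⟨key, ?_, ?_, ?_⟩ <;> refine forall_congr' fun x => ?_ <;> rw [key] <;> constructor <;>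
    intro h <;> linarith
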